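/- Let $p$ be a prime number. An analytic field is a field $K$ that is complete with respect to a multiplicative nonarchimedean norm $|\cdot|$; write $\mathfrak{o}_K=\{x\in K: |x|\le 1\}$ and $\mathfrak{m}_K=\{x\in K:|x|<1\}$. An analytic field $K$ is called perfectoid if $|p|=p^{-1}$, the residue field $\mathfrak{o}_K/\mathfrak{m}_K$ has characteristic $p$, $K$ is not discretely valued, and the $p$-th power map on $\mathfrak{o}_K/(p)$ is surjective. Every finite extension $L$ of an analytic field $K$ is an analytic field for the unique extension of the norm of $K$ to a multiplicative norm on $L$, and $\mathfrak{o}_L$ is defined with respect to this norm. Theorem. Every perfectoid analytic field $K$ is deeply ramified; that is, for every finite extension $L$ of $K$, the module of Kähler differentials $\Omega_{\mathfrak{o}_L/\mathfrak{o}_K}$ is zero. -/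

import Mathlib

universe u v

/- An analytic field is a field `K` that is complete for a multiplicative nonarchimedean norm:
`[NormedField K] [IsUltrametricDist K] [CompleteSpace K]`. -/

/-- The valuation ring `𝔬_K = {x ∈ K : ‖x‖ ≤ 1}` of a nonarchimedean normed field. -/
noncomputable abbrev integerRing (K : Type*) [NormedField K] [IsUltrametricDist K] :
    ValuationSubring K :=
  (NormedField.valuation (K := K)).valuationSubring

/-- An analytic field has mixed characteristics `(0, p)`, with the norm normalized by
`|p| = p⁻¹`, and its residue field `𝔬_K / 𝔪_K` has characteristic `p`. -/
structure HasMixedCharacteristics (p : ℕ) (K : Type*) [NormedField K] [IsUltrametricDist K] :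
    Prop where
  norm_p : ‖(p : K)‖ = (p : ℝ)⁻¹
  charP_residueField : CharP (IsLocalRing.ResidueField (integerRing K)) p

/-- Perfectoid analytic fields: mixed characteristics, not discretely valued, and the `p`-th power
map on `𝔬_K / (p)` is surjective. -/
structure IsPerfectoidField (p : ℕ) (K : Type*) [NormedField K] [IsUltrametricDist K] :
    Prop where
  mixedCharacteristics : HasMixedCharacteristics p K
  not_discrete : ¬ (NormedField.valuation (K := K)).IsRankOneDiscrete
  frobenius_surjective : Function.Surjective
    (fun x : integerRing K ⧸ Ideal.span {(p : integerRing K)} => x ^ p)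

/-- The valuation ring `𝔬_L = {x ∈ L : |x| ≤ 1}` of an algebraic extension `L` of an analytic field
`K`, as an `𝔬_K`-algebra. Here `|x|` is the unique extension of the norm of `K` to a multiplicative
norm on `L`, which is Mathlib's `spectralNorm K L`. -/
noncomputable def extensionIntegerRing (K : Type*) [NormedField K] [IsUltrametricDist K]
    (L : Type*) [Field L] [Algebra K L] [Algebra.IsAlgebraic K L] :
    Subalgebra (integerRing K) L where
  carrier := {x | spectralNorm K L x ≤ 1}
  mul_mem' {x y} hx hy :=
    (spectralNorm_mul (Algebra.IsAlgebraic.isAlgebraic x)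
      (Algebra.IsAlgebraic.isAlgebraic y)).trans
      (mul_le_one₀ hx (spectralNorm_nonneg y) hy)
  add_mem' {x y} hx hy := (isNonarchimedean_spectralNorm x y).trans (max_le hx hy)
  algebraMap_mem' r := (spectralNorm_extends (L := L) (r : K)).trans_le r.2

/-- An analytic field `K` is deeply ramified if `Ω_{𝔬_L/𝔬_K} = 0` for every finite extension
`L` of `K`. -/
def IsDeeplyRamified (K : Type u) [NormedField K] [IsUltrametricDist K] : Prop :=
  ∀ (L : Type v) [Field L] [Algebra K L] [FiniteDimensional K L],
    Subsingleton (Ω[extensionIntegerRing K L⁄integerRing K])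

/-! # Perfectoid fields are deeply ramified

Let `L / K` be finite of degree `n`. The heart of the matter is a weak form of almost purity
(`IsPerfectoidField.exists_spectralNorm_sub_pow_le`): there is `r < 1` such that every `x ∈ 𝔬_L` has
the form `a ^ p + e` with `a ∈ 𝔬_L` and `|e| ≤ r`. Since `K` is not discretely valued, there is
`ϖ ∈ K` with `max r |p| ≤ |ϖ| < 1`, so `x = a ^ p + ϖ z` and `dx = p a ^ (p - 1) da + ϖ dz`. Hence
`Ω = ϖ Ω`. On the other hand a discriminant times a different kills `Ω`
(`exists_ne_zero_smul_D_eq_zero`), and it divides a power of `ϖ`; so `Ω = 0`.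

The approximate `p`-th roots come from a Galois average in characteristic `p`, inside
`S = lim (𝔬_M / {|x| ≤ s})` (limit along Frobenius), where `M` is an algebraic closure of `L` and
`s ^ n = |p|`. This ring is a domain, and `G = Gal(M / L)` acts on it.
* As Frobenius is surjective on `𝔬_K / p`, the minimal polynomial of `x` over `𝔬_K` lifts to a
  sequence of polynomials over `𝔬_K`, each congruent modulo `p` to the Frobenius twist of the next.
  Following a root along this sequence costs an error of at most `|p| ^ (1 / n)`, which gives
  `y ∈ S` with constant term `x`, a root of a nonzero polynomial `g` with `G`-invariant coefficients
  (`exists_perfection_root`).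
* Let `Y` be the finite `G`-stable set of the roots of `g` with constant term `x`. By independence of
  characters some power sum `T = ∑ v ^ e` over `Y` is nonzero. The elements
  `T ^ (1 / p ^ k) = ∑ v ^ (e / p ^ k)` and `∑ v ^ (e / p ^ k) * v` are `G`-invariant, and the
  constant term of the second is `x` times that of the first. For large `k` the constant term of
  `T ^ (1 / p ^ k)` has norm close to `1`, so that one may divide by it
  (`exists_norm_sub_pow_le`).
* Constant terms of `G`-invariant elements of `S` come from `L`
  (`exists_coeff_zero_eq_algebraMap`). This rests on Ax's lemma
  (`exists_norm_sub_algebraMap_le`): an element of `M` moved by at most `ρ` under `G` has distance at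
  most `p ^ 2 * ρ` from `L`. It follows by induction on the degree from the location of the
  roots of Hasse derivatives of minimal polynomials.
-/

open Polynomial
open scoped NNReal

/-! ### Polynomials over ultrametric fields -/

section Ultrametric

variable {M : Type*} [NormedField M]

/-- If `‖f(x)‖ ≤ ‖lc f‖ * ρ ^ deg f`, then `f` has a root at distance at most `ρ` from `x`. -/
theorem exists_isRoot_norm_sub_le [IsAlgClosed M] {f : M[X]} (hf : f.natDegree ≠ 0) (x : M)
    {ρ : ℝ} (hρ : 0 ≤ ρ) (h : ‖f.eval x‖ ≤ ‖f.leadingCoeff‖ * ρ ^ f.natDegree) :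
    ∃ β, f.IsRoot β ∧ ‖x - β‖ ≤ ρ := by
  by_contra! hcon
  have hf0 : f ≠ 0 := by rintro rfl; simp at hf
  have hlc : 0 < ‖f.leadingCoeff‖ := by simpa using hf0
  have hs := IsAlgClosed.splits f
  have hcard := splits_iff_card_roots.mp hs
  have key : ∀ s : Multiset M, (∀ b ∈ s, ρ < ‖x - b‖) → s ≠ 0 →
      ρ ^ Multiset.card s < ‖(s.map fun b => x - b).prod‖ := by
    intro s
    induction s using Multiset.induction with
    | empty => simp
    | cons a s ih =>
      intro hs _
      have ha := hs a (by simp)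
      by_cases h0 : s = 0
      · subst h0; simpa using ha
      · have := ih (fun b hb => hs b (by simp [hb])) h0
        simp only [Multiset.card_cons, pow_succ', Multiset.map_cons, Multiset.prod_cons, norm_mul]
        exact mul_lt_mul'' ha this hρ (by positivity)
  have h1 := key f.roots (fun b hb => hcon b (isRoot_of_mem_roots hb))
    (by rw [← Multiset.card_pos, hcard]; omega)
  have h2 : f.eval x = f.leadingCoeff * (f.roots.map fun b => x - b).prod := by
    conv_lhs => rw [hs.eq_prod_roots]
    simp [eval_mul, eval_multiset_prod, Multiset.map_map]
  rw [h2, norm_mul, ← hcard] at h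
  exact absurd (le_of_mul_le_mul_left h hlc) (not_le.mpr h1)

variable [IsUltrametricDist M]

theorem norm_coeff_prod_X_sub_C_le {r : ℝ} (hr : 0 ≤ r) (s : Multiset M) (hs : ∀ b ∈ s, ‖b‖ ≤ r)
    {k : ℕ} (hk : k ≤ Multiset.card s) :
    ‖((s.map fun b => X - C b).prod).coeff k‖ ≤ r ^ (Multiset.card s - k) := by
  induction s using Multiset.induction generalizing k with
  | empty => simp at hk; simp [hk]
  | cons a s ih =>
    have ih' := fun {k} => @ih (fun b hb => hs b (by simp [hb])) k
    have ha := hs a (by simp)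
    simp only [Multiset.map_cons, Multiset.prod_cons, Multiset.card_cons] at hk ⊢
    have hdeg : ((s.map fun b => X - C b).prod).natDegree = Multiset.card s := by
      rw [natDegree_multiset_prod_X_sub_C_eq_card]
    have hmul : ∀ k, k ≤ Multiset.card s →
        ‖a * ((s.map fun b => X - C b).prod).coeff k‖ ≤ r ^ (Multiset.card s + 1 - k) := by
      intro k hk
      rw [norm_mul, Nat.sub_add_comm hk, pow_succ']
      exact mul_le_mul ha (ih' hk) (norm_nonneg _) hr
    rw [sub_mul, coeff_sub, coeff_C_mul]
    rcases k with _ | k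
    · simpa using hmul 0 (Nat.zero_le _)
    · rw [coeff_X_mul, sub_eq_add_neg]
      refine (IsUltrametricDist.norm_add_le_max _ _).trans (max_le ?_ ?_)
      · simpa using ih' (k := k) (by omega)
      · rw [norm_neg]
        rcases Nat.lt_or_ge (Multiset.card s) (k + 1) with h | h
        · rw [coeff_eq_zero_of_natDegree_lt (by omega)]
          simp only [mul_zero, norm_zero]; positivity
        · exact hmul _ h

/-- If all roots of the monic polynomial `f` lie within `r` of `x`, then the `k`-th Taylor
coefficient of `f` at `x` is at most `r ^ (deg f - k)`. -/
theorem norm_eval_hasseDeriv_le [IsAlgClosed M] {f : M[X]} (hf : f.Monic) {x : M} {r : ℝ}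
    (hr : 0 ≤ r) (h : ∀ b, f.IsRoot b → ‖b - x‖ ≤ r) {k : ℕ} (hk : k ≤ f.natDegree) :
    ‖(hasseDeriv k f).eval x‖ ≤ r ^ (f.natDegree - k) := by
  have hs := IsAlgClosed.splits f
  have hcard := splits_iff_card_roots.mp hs
  have hT : taylor x f = ((f.roots.map fun b => b - x).map fun b => X - C b).prod := by
    conv_lhs => rw [hs.eq_prod_roots, hf.leadingCoeff, C_1, one_mul]
    rw [← taylorAlgHom_apply, map_multiset_prod, Multiset.map_map, Multiset.map_map]
    congr 1
    refine Multiset.map_congr rfl fun b _ => ?_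
    simp [taylor_X, taylor_C]; ring
  rw [← taylor_coeff, hT]
  have := norm_coeff_prod_X_sub_C_le hr (f.roots.map fun b => b - x) (k := k) (by
    intro b hb
    obtain ⟨c, hc, rfl⟩ := Multiset.mem_map.mp hb
    exact h c (isRoot_of_mem_roots hc)) (by simpa [hcard] using hk)
  simpa [hcard] using this

end Ultrametric

/-! ### Ax's lemma on almost invariant elements -/

section Ax

theorem not_dvd_choose_prime_pow {p n k : ℕ} [hp : Fact p.Prime] (h1 : p ^ k < n)
    (h2 : n < p ^ (k + 1)) : ¬ p ∣ n.choose (p ^ k) := by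
  have hn : n.choose (p ^ k) ≠ 0 := (Nat.choose_pos h1.le).ne'
  rw [dvd_iff_padicValNat_ne_zero hn, not_not,
    padicValNat_choose h1.le (Nat.lt_succ_self _), Finset.card_eq_zero, Finset.filter_eq_empty_iff]
  intro i _
  rw [not_le]
  rcases Nat.lt_or_ge k i with hi | hi
  · have : p ^ (k + 1) ≤ p ^ i := Nat.pow_le_pow_right hp.1.pos hi
    rw [Nat.mod_eq_of_lt (by omega : p ^ k < p ^ i), Nat.mod_eq_of_lt (by omega)]
    omega
  · rw [Nat.mod_eq_zero_of_dvd (pow_dvd_pow p hi), zero_add]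
    exact Nat.mod_lt _ (pow_pos hp.1.pos _)

variable {p : ℕ} [hp : Fact p.Prime] {M : Type*} [NormedField M] [IsUltrametricDist M]

theorem norm_natCast_eq_one_of_not_dvd (hpM : ‖(p : M)‖ = (p : ℝ)⁻¹) {m : ℕ} (hm : ¬ p ∣ m) :
    ‖(m : M)‖ = 1 := by
  have h1 : (1 : M) = (m : M) * (Nat.gcdA m p : ℤ) + (p : M) * (Nat.gcdB m p : ℤ) := by
    have := Nat.gcd_eq_gcd_ab m p
    rw [((Nat.Prime.coprime_iff_not_dvd hp.1).mpr hm).symm] at this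
    have h := congrArg (Int.cast (R := M)) this
    push_cast at h
    simpa using h
  have hplt : ‖(p : M)‖ < 1 := by
    rw [hpM]; exact inv_lt_one_of_one_lt₀ (by exact_mod_cast hp.1.one_lt)
  refine le_antisymm (IsUltrametricDist.norm_natCast_le_one M m) ?_
  by_contra! hlt
  have hA := IsUltrametricDist.norm_intCast_le_one M (Nat.gcdA m p)
  have hB := IsUltrametricDist.norm_intCast_le_one M (Nat.gcdB m p)
  have : ‖(1 : M)‖ < 1 := by
    rw [h1]
    refine (IsUltrametricDist.norm_add_le_max _ _).trans_lt (max_lt ?_ ?_) <;> rw [norm_mul]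
    · exact (mul_le_of_le_one_right (norm_nonneg _) hA).trans_lt hlt
    · exact (mul_le_of_le_one_right (norm_nonneg _) hB).trans_lt hplt
  simp at this

/-- `p` divides `(p ^ (k + 1)).choose (p ^ k)` exactly once. -/
theorem norm_choose_prime_pow_pred (hpM : ‖(p : M)‖ = (p : ℝ)⁻¹) (k : ℕ) :
    ‖((p ^ (k + 1)).choose (p ^ k) : M)‖ = (p : ℝ)⁻¹ := by
  have hle : p ^ k ≤ p ^ (k + 1) := Nat.pow_le_pow_right hp.1.pos (by omega)
  have hne : (p ^ (k + 1)).choose (p ^ k) ≠ 0 := (Nat.choose_pos hle).ne'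
  have hfac : ((p ^ (k + 1)).choose (p ^ k)).factorization p = 1 := by
    rw [Nat.factorization_choose_prime_pow hp.1 hle (pow_pos hp.1.pos _).ne']
    simp [hp.1.factorization]
  have h1 := Nat.ordProj_mul_ordCompl_eq_self ((p ^ (k + 1)).choose (p ^ k)) p
  have h2 := Nat.not_dvd_ordCompl hp.1 hne
  rw [← h1, Nat.cast_mul, norm_mul, norm_natCast_eq_one_of_not_dvd hpM h2, hfac]
  simp [hpM]

variable {L : Type*} [Field L] [CharZero L] [Algebra L M] [IsAlgClosed M] [Algebra.IsAlgebraic L M]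

/-- One step of Ax's lemma: an element `β` of smaller degree close to `x`, found among the roots of
a Hasse derivative of the minimal polynomial of `x`. -/
theorem exists_natDegree_minpoly_lt (hiso : ∀ (σ : M ≃ₐ[L] M) (x : M), ‖σ x‖ = ‖x‖)
    {x : M} {r : ℝ} (hr : 0 ≤ r)
    (hx : ∀ σ : M ≃ₐ[L] M, ‖σ x - x‖ ≤ r) {q : ℕ}
    (hq : q < (minpoly L x).natDegree) {ρ : ℝ} (hρ : r ≤ ρ)
    (hbin : r ^ ((minpoly L x).natDegree - q) ≤
      ‖(((minpoly L x).natDegree).choose q : M)‖ * ρ ^ ((minpoly L x).natDegree - q)) :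
    ∃ β : M, (minpoly L β).natDegree ≤ (minpoly L x).natDegree - q ∧ ‖x - β‖ ≤ ρ ∧
      ∀ σ : M ≃ₐ[L] M, ‖σ β - β‖ ≤ ρ := by
  have : CharZero M := charZero_of_injective_algebraMap (algebraMap L M).injective
  have : IsAlgClosure L M := ⟨inferInstance, inferInstance⟩
  have : Normal L M := IsAlgClosure.normal L M
  have hint : IsIntegral L x := Algebra.IsIntegral.isIntegral x
  set n := (minpoly L x).natDegree
  set f := minpoly L x with hf
  have hmon : f.Monic := minpoly.monic hint
  set h := hasseDeriv q f with hh
  have hhdeg : h.natDegree = n - q := natDegree_hasseDeriv _ _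
  have hmap : h.map (algebraMap L M) = hasseDeriv q (f.map (algebraMap L M)) := by
    ext i; simp [hh, hasseDeriv_coeff]
  have hlc : (h.map (algebraMap L M)).leadingCoeff = (n.choose q : M) := by
    rw [leadingCoeff_map, leadingCoeff, hhdeg, hh, hasseDeriv_coeff, Nat.sub_add_cancel hq.le]
    have : f.coeff n = 1 := hmon
    rw [this]; simp
  obtain ⟨β, hβ, hxβ⟩ := exists_isRoot_norm_sub_le (f := h.map (algebraMap L M))
    (by rw [natDegree_map, hhdeg]; omega) x (hr.trans hρ) (by
      rw [hlc, natDegree_map, hhdeg, hmap]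
      refine le_trans ?_ hbin
      have := norm_eval_hasseDeriv_le (hmon.map (algebraMap L M)) (x := x) hr (k := q) (by
        intro b hb
        have hb' : aeval b (minpoly L x) = 0 := by simpa [IsRoot, eval_map, aeval_def] using hb
        obtain ⟨σ, rfl⟩ := (minpoly.exists_algEquiv_of_root' (Algebra.IsAlgebraic.isAlgebraic x) hb')
        exact hx σ) (by rw [natDegree_map]; exact hq.le)
      rwa [natDegree_map] at this)
  refine ⟨β, ?_, hxβ, fun σ => ?_⟩
  · rw [← hhdeg]
    refine natDegree_le_of_dvd (minpoly.dvd L β ?_) ?_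
    · simpa [IsRoot, eval_map, aeval_def] using hβ
    · rintro h0; rw [h0] at hhdeg; simp at hhdeg; omega
  · have e : σ β - β = σ (β - x) + ((σ x - x) + (x - β)) := by rw [map_sub]; ring
    rw [e]
    refine (IsUltrametricDist.norm_add_le_max _ _).trans (max_le ?_
      ((IsUltrametricDist.norm_add_le_max _ _).trans (max_le ((hx σ).trans hρ) hxβ)))
    rwa [hiso, norm_sub_rev]

/-- Ax's lemma with an explicit constant: the degrees `p ^ i` passed on the way down to degree `1`
cost a factor of at most `p ^ (1 / 2 ^ (i - 1))` each, and the exponents sum to less than `2`. -/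
theorem exists_norm_sub_algebraMap_le_aux (hpM : ‖(p : M)‖ = (p : ℝ)⁻¹)
    (hiso : ∀ (σ : M ≃ₐ[L] M) (x : M), ‖σ x‖ = ‖x‖) (n : ℕ) :
    ∀ (x : M) (k : ℕ) (r : ℝ), 0 ≤ r → (minpoly L x).natDegree = n → n < p ^ (k + 1) →
      (∀ σ : M ≃ₐ[L] M, ‖σ x - x‖ ≤ r) →
      ∃ a : L, ‖x - algebraMap L M a‖ ≤ (p : ℝ) ^ (2 - 2 * (2⁻¹ : ℝ) ^ k) * r := by
  have hp1 : (1 : ℝ) ≤ p := by exact_mod_cast hp.1.one_le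
  have hp0 : (0 : ℝ) < p := by linarith
  induction n using Nat.strong_induction_on with
  | _ n ih =>
  intro x k r hr hdeg hnk hx
  have hexp : ∀ k : ℕ, (0 : ℝ) ≤ 2 - 2 * (2⁻¹ : ℝ) ^ k := fun k => by
    have : (2⁻¹ : ℝ) ^ k ≤ 1 := pow_le_one₀ (by norm_num) (by norm_num)
    linarith
  have hone : ∀ k : ℕ, (1 : ℝ) ≤ (p : ℝ) ^ (2 - 2 * (2⁻¹ : ℝ) ^ k) := fun k =>
    Real.one_le_rpow hp1 (hexp k)
  have hnpos : 0 < n := hdeg ▸ minpoly.natDegree_pos (Algebra.IsIntegral.isIntegral x)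
  -- the step for `p ^ k < n < p ^ (k + 1)`, where `n.choose (p ^ k)` is a unit
  have step_unit : ∀ k : ℕ, p ^ k < n → n < p ^ (k + 1) →
      ∃ a : L, ‖x - algebraMap L M a‖ ≤ (p : ℝ) ^ (2 - 2 * (2⁻¹ : ℝ) ^ k) * r := by
    intro k h1 h2
    have hq0 : 0 < p ^ k := pow_pos hp.1.pos _
    obtain ⟨β, hβ1, hβ2, hβ3⟩ := exists_natDegree_minpoly_lt hiso hr hx (hdeg ▸ h1)
      (le_refl r) (by
        rw [hdeg, norm_natCast_eq_one_of_not_dvd hpM (not_dvd_choose_prime_pow h1 h2), one_mul])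
    rw [hdeg] at hβ1
    obtain ⟨a, ha⟩ := ih _ (by omega) β k r hr rfl (by omega) hβ3
    refine ⟨a, ?_⟩
    rw [← sub_add_sub_cancel x β]
    exact (IsUltrametricDist.norm_add_le_max _ _).trans
      (max_le (hβ2.trans (le_mul_of_one_le_left hr (hone k))) ha)
  induction k with
  | zero =>
    rcases Nat.lt_or_ge 1 n with h1 | h1
    · exact step_unit 0 (by simpa using h1) hnk
    · have hn1 : (minpoly L x).natDegree = 1 := by omega
      obtain ⟨a, rfl⟩ := minpoly.natDegree_eq_one_iff.mp hn1
      exact ⟨a, by simpa using hr⟩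
  | succ j ihj =>
    rcases lt_trichotomy n (p ^ (j + 1)) with h | h | h
    · obtain ⟨a, ha⟩ := ihj h
      refine ⟨a, ha.trans (mul_le_mul_of_nonneg_right (Real.rpow_le_rpow_of_exponent_le hp1 ?_) hr)⟩
      have : (2⁻¹ : ℝ) ^ (j + 1) ≤ (2⁻¹ : ℝ) ^ j :=
        pow_le_pow_of_le_one (by norm_num) (by norm_num) (by omega)
      linarith
    · -- here `n.choose (p ^ j)` has norm `p⁻¹`, and the loss is at most `p ^ (1 / 2 ^ j)`
      have hq0 : 0 < p ^ j := pow_pos hp.1.pos _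
      have hq : p ^ j < n := by
        rw [h]; exact Nat.pow_lt_pow_right hp.1.one_lt (by omega)
      have hd : 2 ^ j ≤ n - p ^ j := by
        have h2 : 2 * p ^ j ≤ n := by
          rw [h, pow_succ, mul_comm]; exact Nat.mul_le_mul_left _ hp.1.two_le
        have h3 : 2 ^ j ≤ p ^ j := Nat.pow_le_pow_left hp.1.two_le j
        omega
      set ρ : ℝ := (p : ℝ) ^ ((2⁻¹ : ℝ) ^ j) * r with hρ
      have hrρ : r ≤ ρ := le_mul_of_one_le_left hr (Real.one_le_rpow hp1 (by positivity))
      obtain ⟨β, hβ1, hβ2, hβ3⟩ := exists_natDegree_minpoly_lt hiso hr hx (hdeg ▸ hq)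
        hrρ (by
          rw [hdeg, h, norm_choose_prime_pow_pred hpM, ← h, hρ, mul_pow, ← mul_assoc]
          refine le_mul_of_one_le_left (by positivity) ?_
          rw [← Real.rpow_natCast, ← Real.rpow_mul hp0.le, inv_mul_eq_div, one_le_div hp0]
          conv_lhs => rw [← Real.rpow_one (p : ℝ)]
          refine Real.rpow_le_rpow_of_exponent_le hp1 ?_
          rw [inv_pow, inv_mul_eq_div, one_le_div (by positivity)]
          exact_mod_cast hd)
      rw [hdeg] at hβ1
      obtain ⟨a, ha⟩ := ih _ (by omega) β j ρ (hr.trans hrρ) rfl (by omega) hβ3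
      have hC : (p : ℝ) ^ (2 - 2 * (2⁻¹ : ℝ) ^ (j + 1)) * r =
          (p : ℝ) ^ (2 - 2 * (2⁻¹ : ℝ) ^ j) * ρ := by
        rw [hρ, ← mul_assoc, ← Real.rpow_add hp0]
        congr 2
        rw [pow_succ]; ring
      refine ⟨a, ?_⟩
      rw [hC, ← sub_add_sub_cancel x β]
      exact (IsUltrametricDist.norm_add_le_max _ _).trans
        (max_le (hβ2.trans (le_mul_of_one_le_left (hr.trans hrρ) (hone j))) ha)
    · exact step_unit (j + 1) h hnk

/-- **Ax's lemma**: an element that every automorphism over `L` moves by at most `r` lies within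
`p ^ 2 * r` of `L`; the constant does not depend on the degree of the element. -/
theorem exists_norm_sub_algebraMap_le (hpM : ‖(p : M)‖ = (p : ℝ)⁻¹)
    (hiso : ∀ (σ : M ≃ₐ[L] M) (x : M), ‖σ x‖ = ‖x‖) (x : M) {r : ℝ} (hr : 0 ≤ r)
    (hx : ∀ σ : M ≃ₐ[L] M, ‖σ x - x‖ ≤ r) :
    ∃ a : L, ‖x - algebraMap L M a‖ ≤ (p : ℝ) ^ 2 * r := by
  obtain ⟨a, ha⟩ := exists_norm_sub_algebraMap_le_aux hpM hiso _ x _ r hr rfl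
    (Nat.lt_pow_succ_log_self hp.1.one_lt _) hx
  refine ⟨a, ha.trans (mul_le_mul_of_nonneg_right ?_ hr)⟩
  have hp1 : (1 : ℝ) ≤ p := by exact_mod_cast hp.1.one_le
  rw [← Real.rpow_two]
  refine Real.rpow_le_rpow_of_exponent_le hp1 ?_
  have : (0 : ℝ) ≤ (2⁻¹ : ℝ) ^ Nat.log p (minpoly L x).natDegree := by positivity
  linarith

end Ax

/-! ### The perfection of the integers modulo a ball -/

section Ball

variable {M : Type*} [NormedField M] [IsUltrametricDist M]

theorem mem_integerRing {x : M} : x ∈ integerRing M ↔ ‖x‖ ≤ 1 := by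
  rw [Valuation.mem_valuationSubring_iff, NormedField.valuation_apply, ← NNReal.coe_le_coe]
  rfl

theorem norm_coe_integerRing_le_one (x : integerRing M) : ‖(x : M)‖ ≤ 1 := mem_integerRing.mp x.2

variable (M) in
/-- The ideal `{x ∈ 𝔬_M : ‖x‖ ≤ r}` of the valuation ring of `M`. -/
def closedBallIdeal (r : ℝ≥0) : Ideal (integerRing M) where
  carrier := {x | ‖(x : M)‖ ≤ r}
  zero_mem' := by simp
  add_mem' {x y} hx hy := by
    simpa using (IsUltrametricDist.norm_add_le_max (x : M) (y : M)).trans (max_le hx hy)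
  smul_mem' c x hx := by
    simpa using (mul_le_of_le_one_left (norm_nonneg _) (norm_coe_integerRing_le_one c)).trans hx

@[simp]
theorem mem_closedBallIdeal {r : ℝ≥0} {x : integerRing M} :
    x ∈ closedBallIdeal M r ↔ ‖(x : M)‖ ≤ r := Iff.rfl

theorem mk_eq_zero_iff_norm_le {r : ℝ≥0} {x : integerRing M} :
    Ideal.Quotient.mk (closedBallIdeal M r) x = 0 ↔ ‖(x : M)‖ ≤ r :=
  Ideal.Quotient.eq_zero_iff_mem

theorem mk_eq_mk_iff_norm_sub_le {r : ℝ≥0} {x y : integerRing M} :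
    Ideal.Quotient.mk (closedBallIdeal M r) x = Ideal.Quotient.mk (closedBallIdeal M r) y ↔
      ‖(x : M) - y‖ ≤ r := by
  rw [Ideal.Quotient.eq, mem_closedBallIdeal]; simp

theorem charP_quotient_closedBallIdeal {p : ℕ} [hp : Fact p.Prime] {r : ℝ≥0}
    (hpr : ‖(p : M)‖ ≤ r) (hr : r < 1) : CharP (integerRing M ⧸ closedBallIdeal M r) p := by
  have : Nontrivial (integerRing M ⧸ closedBallIdeal M r) := by
    refine Ideal.Quotient.nontrivial_iff.mpr ((Ideal.ne_top_iff_one _).mpr ?_)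
    simpa using hr
  rw [CharP.charP_iff_prime_eq_zero hp.1, ← map_natCast (Ideal.Quotient.mk _),
    mk_eq_zero_iff_norm_le]
  simpa using hpr

theorem norm_le_of_natCast_dvd {p : ℕ} {x : integerRing M} (h : (p : integerRing M) ∣ x) :
    ‖(x : M)‖ ≤ ‖(p : M)‖ := by
  obtain ⟨c, rfl⟩ := h
  simpa using mul_le_of_le_one_right (norm_nonneg _) (norm_coe_integerRing_le_one c)

theorem norm_pow_sub_pow_le {p : ℕ} (hp : p.Prime) {a b : M} (ha : ‖a‖ ≤ 1) (hb : ‖b‖ ≤ 1) :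
    ‖a ^ p - b ^ p‖ ≤ max (‖a - b‖ ^ p) (‖(p : M)‖ * ‖a - b‖) := by
  obtain ⟨s, hs⟩ := exists_add_pow_prime_eq hp (⟨b, mem_integerRing.mpr hb⟩ : integerRing M)
    ⟨a - b, sub_mem (mem_integerRing.mpr ha) (mem_integerRing.mpr hb)⟩
  have h := congrArg (Subtype.val) hs
  have h : a ^ p = b ^ p + (a - b) ^ p + p * b * (a - b) * s := by simpa using h
  have e : a ^ p - b ^ p = (a - b) ^ p + p * b * (a - b) * s := by rw [h]; ring
  rw [e]
  refine (IsUltrametricDist.norm_add_le_max _ _).trans (max_le_max (norm_pow_le _ _) ?_)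
  have hs1 := norm_coe_integerRing_le_one s
  simp only [norm_mul]
  calc ‖(p : M)‖ * ‖b‖ * ‖a - b‖ * ‖(s : M)‖ ≤ ‖(p : M)‖ * 1 * ‖a - b‖ * 1 := by gcongr
    _ = _ := by ring

theorem norm_pow_pow_sub_pow_pow_le {p : ℕ} (hp : p.Prime) {r : ℝ} (hpr : ‖(p : M)‖ ≤ r)
    (hr : r ≤ 1) {a b : M} (ha : ‖a‖ ≤ 1) (hb : ‖b‖ ≤ 1) (hab : ‖a - b‖ ≤ r) (k : ℕ) :
    ‖a ^ p ^ k - b ^ p ^ k‖ ≤ r ^ (k + 1) := by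
  have hr0 : 0 ≤ r := (norm_nonneg _).trans hpr
  induction k with
  | zero => simpa using hab
  | succ k ih =>
    rw [pow_succ p, pow_mul, pow_mul]
    have hle : ‖a ^ p ^ k - b ^ p ^ k‖ ≤ r :=
      ih.trans (pow_le_of_le_one hr0 hr (Nat.succ_ne_zero k))
    have key : ∀ t, 0 ≤ t → t ≤ r → t * ‖a ^ p ^ k - b ^ p ^ k‖ ≤ r ^ (k + 1 + 1) := by
      intro t ht0 ht
      rw [pow_succ' r (k + 1)]
      exact mul_le_mul ht ih (norm_nonneg _) hr0
    refine (norm_pow_sub_pow_le hp (by rw [norm_pow]; exact pow_le_one₀ (norm_nonneg _) ha)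
      (by rw [norm_pow]; exact pow_le_one₀ (norm_nonneg _) hb)).trans (max_le ?_ ?_)
    · refine le_trans ?_ (key _ (norm_nonneg _) hle)
      rw [← sq]
      exact pow_le_pow_of_le_one (norm_nonneg _) (hle.trans hr) hp.two_le
    · exact key _ (norm_nonneg _) hpr

end Ball

section Perfection

variable {p : ℕ} [hp : Fact p.Prime] {M : Type*} [NormedField M] [IsUltrametricDist M] {r : ℝ≥0}
  [CharP (integerRing M ⧸ closedBallIdeal M r) p]

local notation "𝒪" => integerRing M ⧸ closedBallIdeal M r

/-- Lifts of the coefficients of an element of the perfection have compatible norms as soon as they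
are visible outside the ball. -/
theorem norm_pow_eq_of_lifts_coeff (u : Perfection 𝒪 p) {i k : ℕ} {a b : integerRing M}
    (hb : Ideal.Quotient.mk (closedBallIdeal M r) b = Perfection.coeff _ p i u)
    (ha : Ideal.Quotient.mk (closedBallIdeal M r) a = Perfection.coeff _ p (i + k) u)
    (hbr : r < ‖(b : M)‖) : ‖(a : M)‖ ^ p ^ k = ‖(b : M)‖ := by
  have h : Ideal.Quotient.mk (closedBallIdeal M r) (a ^ p ^ k) =
      Ideal.Quotient.mk (closedBallIdeal M r) b := by
    rw [hb, map_pow, ha]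
    exact Perfection.coeffMonoidHom_pow_p_pow' u i k
  rw [mk_eq_mk_iff_norm_sub_le] at h
  have h' : ‖((a ^ p ^ k : integerRing M) : M) - b‖ < ‖(b : M)‖ := h.trans_lt hbr
  have := IsUltrametricDist.norm_add_eq_max_of_norm_ne_norm h'.ne
  rw [sub_add_cancel, max_eq_right h'.le] at this
  simpa using this

theorem exists_coeff_ne_zero {u : Perfection 𝒪 p} (hu : u ≠ 0) :
    ∃ i, Perfection.coeff _ p i u ≠ 0 := by
  by_contra! h
  exact hu (Perfection.ext fun n => by rw [h n, map_zero])

variable (p) in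
theorem isDomain_perfection_quotient_closedBallIdeal (hr : r < 1) : IsDomain (Perfection 𝒪 p) := by
  have : Nontrivial 𝒪 := by
    refine Ideal.Quotient.nontrivial_iff.mpr ((Ideal.ne_top_iff_one _).mpr ?_)
    simpa using hr
  have : Nontrivial (Perfection 𝒪 p) := (Perfection.coeff 𝒪 p 0).domain_nontrivial
  have : NoZeroDivisors (Perfection 𝒪 p) := by
    refine ⟨fun {u v} huv => ?_⟩
    by_contra! hne
    obtain ⟨i, hi⟩ := exists_coeff_ne_zero hne.1
    obtain ⟨j, hj⟩ := exists_coeff_ne_zero hne.2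
    have lift : ∀ w : Perfection 𝒪 p, Perfection.coeff _ p (max i j) w ≠ 0 →
        ∃ a : integerRing M, Ideal.Quotient.mk (closedBallIdeal M r) a =
          Perfection.coeff _ p (max i j + 1) w ∧ (r : ℝ) < ‖(a : M)‖ ^ p := by
      intro w hw
      obtain ⟨b, hb⟩ := Ideal.Quotient.mk_surjective (Perfection.coeff _ p (max i j) w)
      obtain ⟨a, ha⟩ := Ideal.Quotient.mk_surjective (Perfection.coeff _ p (max i j + 1) w)
      have hbr : (r : ℝ) < ‖(b : M)‖ := by
        rw [← hb, Ne, mk_eq_zero_iff_norm_le, not_le] at hw; exact hw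
      have := norm_pow_eq_of_lifts_coeff w hb ha hbr
      rw [pow_one] at this
      exact ⟨a, ha, this ▸ hbr⟩
    obtain ⟨a, ha, har⟩ := lift u (Perfection.coeff_ne_zero_of_le hi (le_max_left _ _))
    obtain ⟨b, hb, hbr⟩ := lift v (Perfection.coeff_ne_zero_of_le hj (le_max_right _ _))
    have h0 : Ideal.Quotient.mk (closedBallIdeal M r) (a * b) = 0 := by
      rw [map_mul, ha, hb, ← map_mul, huv, map_zero]
    rw [mk_eq_zero_iff_norm_le] at h0
    -- `r < ‖a‖ ^ p` and `r < ‖b‖ ^ p` give `‖a * b‖ ^ p > r ^ 2 ≥ r ^ p`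
    have h1 : (r : ℝ) ^ 2 < ‖((a * b : integerRing M) : M)‖ ^ p := by
      simp only [MulMemClass.coe_mul, norm_mul, mul_pow, sq]
      exact mul_lt_mul'' har hbr r.2 r.2
    have h2 : ‖((a * b : integerRing M) : M)‖ ^ p ≤ (r : ℝ) ^ p :=
      pow_le_pow_left₀ (norm_nonneg _) h0 p
    have h3 : (r : ℝ) ^ p ≤ (r : ℝ) ^ 2 :=
      pow_le_pow_of_le_one r.2 (by exact_mod_cast hr.le) hp.1.two_le
    linarith
  exact NoZeroDivisors.to_isDomain (Perfection 𝒪 p)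

/-- The endomorphism of `𝔬_M` induced by a norm-preserving endomorphism of `M`. -/
noncomputable def integerRingMap (φ : M →+* M) (hφ : ∀ x, ‖φ x‖ = ‖x‖) :
    integerRing M →+* integerRing M :=
  (φ.comp (integerRing M).subtype).codRestrict (integerRing M) fun x =>
    mem_integerRing.mpr ((hφ x).trans_le (norm_coe_integerRing_le_one x))

@[simp]
theorem coe_integerRingMap (φ : M →+* M) (hφ : ∀ x, ‖φ x‖ = ‖x‖) (x : integerRing M) :
    (integerRingMap φ hφ x : M) = φ x := rfl

variable (p r) in
/-- The endomorphism of the perfection of `𝔬_M / {‖x‖ ≤ r}` induced by a norm-preserving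
endomorphism of `M`. -/
noncomputable def perfectionMap (φ : M →+* M) (hφ : ∀ x, ‖φ x‖ = ‖x‖) :
    Perfection 𝒪 p →+* Perfection 𝒪 p :=
  Perfection.map p (Ideal.quotientMap (closedBallIdeal M r) (integerRingMap φ hφ) fun x hx => by
    simpa [hφ] using hx)

theorem coeff_perfectionMap (φ : M →+* M) (hφ : ∀ x, ‖φ x‖ = ‖x‖) (u : Perfection 𝒪 p) {i : ℕ}
    {a : integerRing M}
    (ha : Ideal.Quotient.mk (closedBallIdeal M r) a = Perfection.coeff _ p i u) :
    Perfection.coeff _ p i (perfectionMap p r φ hφ u) =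
      Ideal.Quotient.mk (closedBallIdeal M r) (integerRingMap φ hφ a) := by
  rw [perfectionMap, Perfection.coeff_map, ← ha, Ideal.quotientMap_mk]

/-- The `N`-fold `p`-th root on the perfection. -/
noncomputable def perfectionRoot (N : ℕ) : Perfection 𝒪 p →+* Perfection 𝒪 p :=
  (Perfection.pthRoot 𝒪 p) ^ N

theorem coeff_perfectionRoot (N i : ℕ) (u : Perfection 𝒪 p) :
    Perfection.coeff _ p i (perfectionRoot N u) = Perfection.coeff _ p (i + N) u := by
  rw [perfectionRoot, RingHom.coe_pow, Perfection.coe_pthRoot_eq_symm_frobeniusEquiv,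
    Perfection.coeff_iterate_symm_frobeniusEquiv]

theorem perfectionMap_perfectionRoot (φ : M →+* M) (hφ : ∀ x, ‖φ x‖ = ‖x‖) (N : ℕ)
    (u : Perfection 𝒪 p) :
    perfectionMap p r φ hφ (perfectionRoot N u) = perfectionRoot N (perfectionMap p r φ hφ u) := by
  refine Perfection.ext fun i => ?_
  obtain ⟨a, ha⟩ := Ideal.Quotient.mk_surjective (Perfection.coeff _ p (i + N) u)
  rw [coeff_perfectionRoot, coeff_perfectionMap φ hφ u ha,
    coeff_perfectionMap φ hφ (perfectionRoot N u) (by rw [coeff_perfectionRoot, ha])]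

end Perfection

/-! ### Galois descent from the perfection -/

section Descent

variable {p : ℕ} [hp : Fact p.Prime] {M : Type*} [NormedField M] [IsUltrametricDist M] {r : ℝ≥0}
  [CharP (integerRing M ⧸ closedBallIdeal M r) p]
  {L : Type*} [Field L] [CharZero L] [Algebra L M] [IsAlgClosed M] [Algebra.IsAlgebraic L M]

/-- The constant term of a Galois invariant element of the perfection comes from `L`. Lifting the
`k`-th coefficient and raising to the power `p ^ k` gives an element that is invariant up to
`r ^ (k + 1)`, and Ax's lemma applies to it. -/
theorem exists_coeff_zero_eq_algebraMap (hpM : ‖(p : M)‖ = (p : ℝ)⁻¹) (hpr : ‖(p : M)‖ ≤ r)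
    (hr : r < 1) (hiso : ∀ (σ : M ≃ₐ[L] M) (x : M), ‖σ x‖ = ‖x‖)
    (u : Perfection (integerRing M ⧸ closedBallIdeal M r) p)
    (hu : ∀ σ : M ≃ₐ[L] M, perfectionMap p r (σ : M →+* M) (hiso σ) u = u) :
    ∃ (a : L) (b : integerRing M), algebraMap L M a = b ∧
      Ideal.Quotient.mk (closedBallIdeal M r) b = Perfection.coeff _ p 0 u := by
  have hp0 : (0 : ℝ) < p := by exact_mod_cast hp.1.pos
  have hr0 : (0 : ℝ) < r := lt_of_lt_of_le (by rw [hpM]; positivity) hpr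
  have hr1 : (r : ℝ) < 1 := by exact_mod_cast hr
  obtain ⟨k, hk⟩ : ∃ k : ℕ, (p : ℝ) ^ 2 * (r : ℝ) ^ (k + 1) ≤ r := by
    obtain ⟨k, hk⟩ := exists_pow_lt_of_lt_one (y := (r : ℝ)) (x := (p ^ 2 : ℝ)⁻¹)
      (by positivity) hr1
    refine ⟨k, ?_⟩
    rw [pow_succ (r : ℝ), ← mul_assoc]
    refine mul_le_of_le_one_left hr0.le ?_
    rw [← le_div_iff₀' (by positivity), one_div]
    exact hk.le
  obtain ⟨z, hz⟩ := Ideal.Quotient.mk_surjective (Perfection.coeff _ p k u)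
  obtain ⟨a, ha⟩ := exists_norm_sub_algebraMap_le (L := L) hpM hiso ((z : M) ^ p ^ k)
    (r := (r : ℝ) ^ (k + 1)) (by positivity) (by
      intro σ
      rw [map_pow]
      refine norm_pow_pow_sub_pow_pow_le hp.1 hpr hr1.le
        ((hiso σ _).trans_le (norm_coe_integerRing_le_one z)) (norm_coe_integerRing_le_one z) ?_ k
      have h := coeff_perfectionMap (σ : M →+* M) (hiso σ) u hz
      rw [hu, ← hz, mk_eq_mk_iff_norm_sub_le, norm_sub_rev] at h
      exact h)
  have ha' := ha.trans hk
  have hmem : algebraMap L M a ∈ integerRing M := by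
    have e : algebraMap L M a = (z : M) ^ p ^ k - ((z : M) ^ p ^ k - algebraMap L M a) := by ring
    rw [e]
    exact sub_mem (pow_mem z.2 _) (mem_integerRing.mpr (ha'.trans hr1.le))
  refine ⟨a, ⟨_, hmem⟩, rfl, ?_⟩
  have h0 : Ideal.Quotient.mk (closedBallIdeal M r) (z ^ p ^ k) = Perfection.coeff _ p 0 u := by
    rw [map_pow, hz]
    exact Perfection.coeffMonoidHom_pow_p_pow_self u k
  rw [← h0, eq_comm, mk_eq_mk_iff_norm_sub_le]
  simpa using ha'

end Descent

/-! ### Lifting roots along Frobenius -/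

section Lifting

variable {p : ℕ} [hp : Fact p.Prime] {A : Type*} [CommRing A]
  {M : Type*} [NormedField M] [IsUltrametricDist M] [IsAlgClosed M]

/-- If Frobenius is surjective on `A / p`, then a monic polynomial `f` over `A` is congruent modulo
`p` to the Frobenius twist of a monic `g`, and each integral root `x` of `f` is close to the `p`-th
power of a root of `g`. -/
theorem exists_monic_root_pow_sub_le [CharP (A ⧸ Ideal.span {(p : A)}) p]
    (hA : Function.Surjective (fun x : A ⧸ Ideal.span {(p : A)} => x ^ p))
    (hpM : ‖(p : M)‖ < 1) (j : A →+* integerRing M) {f : A[X]} (hf : f.Monic) {d : ℕ}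
    (hd : f.natDegree = d) (hd0 : d ≠ 0) {x : integerRing M} (hx : f.eval₂ j x = 0) :
    ∃ (g : A[X]) (x' : integerRing M), g.Monic ∧ g.natDegree = d ∧ g.eval₂ j x' = 0 ∧
      ‖(x' : M) ^ p - x‖ ^ d ≤ ‖(p : M)‖ ∧ ∀ i, (p : A) ∣ g.coeff i ^ p - f.coeff i := by
  have hA0 : Nontrivial (A ⧸ Ideal.span {(p : A)}) := CharP.nontrivial_of_char_ne_one hp.1.ne_one
  have hAnt : Nontrivial A := (Ideal.Quotient.mk (Ideal.span {(p : A)})).domain_nontrivial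
  set π := Ideal.Quotient.mk (Ideal.span {(p : A)}) with hπ
  set ψ : A →+* A ⧸ Ideal.span {(p : A)} := (frobenius _ p).comp π with hψ
  have hψs : Function.Surjective ψ := by
    intro y
    obtain ⟨z, rfl⟩ := hA y
    obtain ⟨a, rfl⟩ := Ideal.Quotient.mk_surjective z
    exact ⟨a, rfl⟩
  obtain ⟨g, hg1, hg2, hg3⟩ := lifts_and_natDegree_eq_and_monic (f := ψ) (p := f.map π)
    (map_surjective ψ hψs _) (hf.map π)
  rw [hf.natDegree_map, hd] at hg2
  have hcoeff : ∀ i, (p : A) ∣ g.coeff i ^ p - f.coeff i := by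
    intro i
    have := congrArg (fun q => coeff q i) hg1
    simp only [coeff_map, hψ, RingHom.comp_apply, frobenius_def, ← map_pow] at this
    rw [← Ideal.mem_span_singleton]
    exact Ideal.Quotient.eq.mp this
  obtain ⟨w0, hw0⟩ := IsAlgClosed.exists_pow_nat_eq (x : M) hp.1.pos
  have hw1 : ‖w0‖ ≤ 1 := by
    have : ‖w0‖ ^ p ≤ 1 := by rw [← norm_pow, hw0]; exact norm_coe_integerRing_le_one x
    exact (pow_le_one_iff_of_nonneg (norm_nonneg _) hp.1.ne_zero).mp this
  set w : integerRing M := ⟨w0, mem_integerRing.mpr hw1⟩ with hw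
  have hwp : w ^ p = x := Subtype.ext hw0
  -- modulo `p`, the value `g(w) ^ p` is `f(x) = 0`
  set v := g.eval₂ j w with hv
  have hvp : (p : integerRing M) ∣ v ^ p := by
    set J := Ideal.span {(p : integerRing M)}
    have hpJ : (p : integerRing M) ∈ nonunits (integerRing M) := by
      intro hu
      obtain ⟨c, hc⟩ := isUnit_iff_exists_inv.mp hu
      have h1 := norm_le_of_natCast_dvd (M := M) (p := p) (x := 1) ⟨c, hc.symm⟩
      simp only [OneMemClass.coe_one, norm_one] at h1
      linarith
    have := CharP.quotient (integerRing M) p hpJ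
    have hle : Ideal.span {(p : A)} ≤ J.comap j := by
      rw [Ideal.span_le, Set.singleton_subset_iff]
      simp only [SetLike.mem_coe, Ideal.mem_comap, map_natCast]
      exact Ideal.mem_span_singleton_self _
    set jbar : A ⧸ Ideal.span {(p : A)} →+* integerRing M ⧸ J := Ideal.quotientMap J j hle
    rw [← Ideal.mem_span_singleton, ← Ideal.Quotient.eq_zero_iff_mem, map_pow, ← frobenius_def, hv,
      hom_eval₂, hom_eval₂, frobenius_def, ← map_pow, hwp]
    have e1 : (frobenius (integerRing M ⧸ J) p).comp ((Ideal.Quotient.mk J).comp j) =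
        jbar.comp ψ := by
      ext a
      simp [jbar, hψ, frobenius_def, hπ]
    have e2 : jbar.comp π = (Ideal.Quotient.mk J).comp j := by
      ext a; simp [jbar, hπ]
    rw [e1, ← eval₂_map, hg1, eval₂_map, e2, ← hom_eval₂, hx, map_zero]
  have hvn : ‖(v : M)‖ ^ p ≤ ‖(p : M)‖ := by simpa using norm_le_of_natCast_dvd hvp
  set G : M[X] := g.map ((integerRing M).subtype.comp j) with hG
  have hGm : G.Monic := hg3.map _
  have hGd : G.natDegree = d := by rw [hG, hg3.natDegree_map, hg2]
  have hGe : ∀ z : integerRing M, G.eval (z : M) = (g.eval₂ j z : integerRing M) := by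
    intro z
    rw [hG, eval_map]
    exact (hom_eval₂ g j (integerRing M).subtype z).symm
  have hρ : (‖(v : M)‖ ^ (d : ℝ)⁻¹) ^ d = ‖(v : M)‖ :=
    Real.rpow_inv_natCast_pow (norm_nonneg _) hd0
  obtain ⟨y, hy, hyw⟩ := exists_isRoot_norm_sub_le (f := G) (by rwa [hGd]) (w : M)
    (ρ := ‖(v : M)‖ ^ (d : ℝ)⁻¹) (by positivity) (by
      rw [hGd, hGm.leadingCoeff, norm_one, one_mul, hρ, hGe])
  rw [norm_sub_rev] at hyw
  have hyw1 : ‖y - (w : M)‖ ≤ 1 :=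
    hyw.trans (Real.rpow_le_one (norm_nonneg _) (norm_coe_integerRing_le_one v) (by positivity))
  have hyO : y ∈ integerRing M := by
    rw [← sub_add_cancel y (w : M)]
    exact add_mem (mem_integerRing.mpr hyw1) w.2
  refine ⟨g, ⟨y, hyO⟩, hg3, hg2, Subtype.ext ?_, ?_, hcoeff⟩
  · rw [← hGe]; exact hy
  · have hxw : (x : M) = (w : M) ^ p := hw0.symm
    have h1 := norm_pow_sub_pow_le hp.1 (mem_integerRing.mp hyO) hw1
    rw [hxw]
    rcases le_max_iff.mp h1 with h | h
    · calc ‖y ^ p - (w : M) ^ p‖ ^ d ≤ (‖y - (w : M)‖ ^ p) ^ d :=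
            pow_le_pow_left₀ (norm_nonneg _) h d
        _ = (‖y - (w : M)‖ ^ d) ^ p := by rw [← pow_mul, ← pow_mul, mul_comm]
        _ ≤ ((‖(v : M)‖ ^ (d : ℝ)⁻¹) ^ d) ^ p := by gcongr
        _ ≤ ‖(p : M)‖ := by rw [hρ]; exact hvn
    · have h2 : ‖y ^ p - (w : M) ^ p‖ ≤ ‖(p : M)‖ :=
        h.trans (mul_le_of_le_one_right (norm_nonneg _) hyw1)
      exact (pow_le_pow_left₀ (norm_nonneg _) h2 d).trans
        (pow_le_of_le_one (norm_nonneg _) hpM.le hd0)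

/-- A root of a monic polynomial over `A` lifts to a root, in the perfection of `𝔬_M / {‖x‖ ≤ r}`, of
a nonzero polynomial whose coefficients are invariant under all norm-preserving endomorphisms of `M`
that fix the image of `A`. -/
theorem exists_perfection_root [CharP (A ⧸ Ideal.span {(p : A)}) p]
    (hA : Function.Surjective (fun x : A ⧸ Ideal.span {(p : A)} => x ^ p))
    (hpM : ‖(p : M)‖ < 1) (j : A →+* integerRing M) {f : A[X]} (hf : f.Monic)
    (hd0 : f.natDegree ≠ 0) {x : integerRing M} (hx : f.eval₂ j x = 0) {r : ℝ≥0} (hr : r < 1)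
    (hpr : ‖(p : M)‖ ≤ (r : ℝ) ^ f.natDegree)
    [CharP (integerRing M ⧸ closedBallIdeal M r) p] :
    ∃ (g : (Perfection (integerRing M ⧸ closedBallIdeal M r) p)[X])
      (y : Perfection (integerRing M ⧸ closedBallIdeal M r) p),
      g ≠ 0 ∧ g.IsRoot y ∧ Perfection.coeff _ p 0 y = Ideal.Quotient.mk _ x ∧
      ∀ (φ : M →+* M) (hφ : ∀ x, ‖φ x‖ = ‖x‖), (∀ a, φ (j a : M) = j a) →
        g.map (perfectionMap p r φ hφ) = g := by
  set d := f.natDegree with hd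
  let Good : A[X] × integerRing M → Prop := fun t =>
    t.1.Monic ∧ t.1.natDegree = d ∧ t.1.eval₂ j t.2 = 0
  have step : ∀ t : {t // Good t}, ∃ t' : {t // Good t},
      ‖(t'.1.2 : M) ^ p - t.1.2‖ ^ d ≤ ‖(p : M)‖ ∧
        ∀ i, (p : A) ∣ t'.1.1.coeff i ^ p - t.1.1.coeff i := by
    rintro ⟨⟨f, x⟩, h1, h2, h3⟩
    obtain ⟨g, x', hg1, hg2, hg3, hg4, hg5⟩ :=
      exists_monic_root_pow_sub_le hA hpM j h1 h2 hd0 h3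
    exact ⟨⟨⟨g, x'⟩, hg1, hg2, hg3⟩, hg4, hg5⟩
  choose next hnext1 hnext2 using step
  let s : ℕ → {t // Good t} := fun n => Nat.rec ⟨(f, x), hf, hd.symm, hx⟩ (fun _ t => next t) n
  have hpr' : ‖(p : M)‖ ≤ r := hpr.trans (pow_le_of_le_one r.2 (by exact_mod_cast hr.le) hd0)
  let y : Perfection (integerRing M ⧸ closedBallIdeal M r) p :=
    ⟨fun n => Ideal.Quotient.mk _ (s n).1.2, fun n => by
      rw [← map_pow, mk_eq_mk_iff_norm_sub_le]
      exact le_of_pow_le_pow_left₀ hd0 r.2 ((hnext1 (s n)).trans hpr)⟩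
  let c : ℕ → Perfection (integerRing M ⧸ closedBallIdeal M r) p := fun i =>
    ⟨fun n => Ideal.Quotient.mk _ (j ((s n).1.1.coeff i)), fun n => by
      rw [← map_pow, mk_eq_mk_iff_norm_sub_le]
      have h := norm_le_of_natCast_dvd (M := M) (p := p)
        (x := j ((s (n + 1)).1.1.coeff i) ^ p - j ((s n).1.1.coeff i)) (by
          have := map_dvd j (hnext2 (s n) i)
          simpa using this)
      exact h.trans hpr'⟩
  have hc : ∀ n i, Perfection.coeff _ p n (c i) = Ideal.Quotient.mk _ (j ((s n).1.1.coeff i)) :=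
    fun n i => rfl
  have hy : ∀ n, Perfection.coeff _ p n y = Ideal.Quotient.mk _ (s n).1.2 := fun n => rfl
  refine ⟨∑ i ∈ Finset.range (d + 1), monomial i (c i), y, ?_, ?_, rfl, ?_⟩
  · intro h0
    have h1 := congrArg (fun q => Perfection.coeff _ p 0 (coeff q d)) h0
    simp only [finsetSum_coeff, coeff_monomial, Finset.sum_ite_eq', Finset.mem_range,
      Nat.lt_succ_self, if_true, coeff_zero, map_zero] at h1
    have h2 : f.coeff d = 1 := hf
    change Ideal.Quotient.mk (closedBallIdeal M r) (j (f.coeff d)) = 0 at h1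
    rw [h2, map_one, mk_eq_zero_iff_norm_le] at h1
    simp only [OneMemClass.coe_one, norm_one] at h1
    have : (r : ℝ) < 1 := by exact_mod_cast hr
    linarith
  · refine Perfection.ext fun n => ?_
    obtain ⟨-, h2, h3⟩ := (s n).2
    have h4 := congrArg (Ideal.Quotient.mk (closedBallIdeal M r)) h3
    rw [eval₂_eq_sum_range, h2] at h4
    rw [eval_finsetSum, map_sum, map_zero]
    simpa [hc, hy] using h4
  · intro φ hφ hfix
    rw [Polynomial.map_sum]
    refine Finset.sum_congr rfl fun i _ => ?_
    rw [map_monomial]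
    congr 1
    refine Perfection.ext fun n => ?_
    rw [coeff_perfectionMap φ hφ (c i) (hc n i).symm, hc]
    congr 1
    exact Subtype.ext (hfix _)

end Lifting

/-! ### Approximate `p`-th roots in finite extensions -/

section Approximation

/-- Some power sum of a nonempty finite set does not vanish, by independence of the characters
`e ↦ v ^ e` of `ℕ`. -/
theorem exists_sum_pow_ne_zero {S : Type*} [CommRing S] [IsDomain S] {Y : Finset S}
    (hY : Y.Nonempty) : ∃ e : ℕ, ∑ v ∈ Y, v ^ e ≠ 0 := by
  by_contra! h
  have hli := (linearIndependent_monoidHom (Multiplicative ℕ) S).comp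
    (fun v : S => powersHom S v) (powersHom S).injective
  obtain ⟨v, hv⟩ := hY
  have := (linearIndependent_iff'.mp hli) Y (fun _ => 1) (by
    funext e
    simpa [Finset.sum_apply] using h (Multiplicative.toAdd e)) v hv
  exact one_ne_zero this

variable {p : ℕ} [hp : Fact p.Prime] {A : Type*} [CommRing A]
  {M : Type*} [NormedField M] [IsUltrametricDist M] [IsAlgClosed M]
  {L : Type*} [Field L] [CharZero L] [Algebra L M] [Algebra.IsAlgebraic L M]

/-- An integral `x ∈ L` that is a root of a monic polynomial of degree `d` over `A`, where Frobenius
is surjective on `A / p`, agrees with a `p`-th power of `L` up to `√r`, as soon as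
`‖p‖ ≤ r ^ d`. -/
theorem exists_norm_sub_pow_le [CharP (A ⧸ Ideal.span {(p : A)}) p]
    (hA : Function.Surjective (fun x : A ⧸ Ideal.span {(p : A)} => x ^ p))
    (hpM : ‖(p : M)‖ = (p : ℝ)⁻¹) (hiso : ∀ (σ : M ≃ₐ[L] M) (x : M), ‖σ x‖ = ‖x‖)
    (j : A →+* integerRing M) (hj : ∀ a, ∃ l : L, algebraMap L M l = j a)
    {f : A[X]} (hf : f.Monic) (hd0 : f.natDegree ≠ 0) {x : integerRing M} (hx : f.eval₂ j x = 0)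
    {x₀ : L} (hx₀ : algebraMap L M x₀ = x) {r : ℝ≥0} (hr : r < 1)
    (hpr : ‖(p : M)‖ ≤ (r : ℝ) ^ f.natDegree) :
    ∃ a : L, ‖algebraMap L M a‖ ≤ 1 ∧ ‖algebraMap L M (x₀ - a ^ p)‖ ^ 2 ≤ r := by
  classical
  have hp0 : (0 : ℝ) < p := by exact_mod_cast hp.1.pos
  have hp1 : ‖(p : M)‖ < 1 := by
    rw [hpM]; exact inv_lt_one_of_one_lt₀ (by exact_mod_cast hp.1.one_lt)
  have hr1 : (r : ℝ) < 1 := by exact_mod_cast hr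
  have hpr' : ‖(p : M)‖ ≤ r := hpr.trans (pow_le_of_le_one r.2 hr1.le hd0)
  have hr0 : (0 : ℝ) < r := lt_of_lt_of_le (by rw [hpM]; positivity) hpr'
  have : CharP (integerRing M ⧸ closedBallIdeal M r) p := charP_quotient_closedBallIdeal hpr' hr
  have := isDomain_perfection_quotient_closedBallIdeal p (M := M) hr
  set Q := Perfection (integerRing M ⧸ closedBallIdeal M r) p
  obtain ⟨g, y, hg0, hgy, hy, hginv⟩ := exists_perfection_root hA hp1 j hf hd0 hx hr hpr
  have hiso' : ∀ (σ : M ≃ₐ[L] M) (x : M), ‖(σ : M →+* M) x‖ = ‖x‖ := hiso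
  let Φ : (M ≃ₐ[L] M) → (Q →+* Q) := fun σ => perfectionMap p r (σ : M →+* M) (hiso' σ)
  -- the roots of `g` with the same constant term as `y` form a Galois stable finite set
  set Y : Finset Q := g.roots.toFinset.filter
    (fun v => Perfection.coeff _ p 0 v = Ideal.Quotient.mk _ x) with hYdef
  have hmemY : ∀ v, v ∈ Y ↔ g.IsRoot v ∧ Perfection.coeff _ p 0 v = Ideal.Quotient.mk _ x := by
    intro v; simp [hYdef, hg0]
  have hYne : Y.Nonempty := ⟨y, (hmemY y).mpr ⟨hgy, hy⟩⟩
  have hΦY : ∀ σ, Y.image (Φ σ) = Y := by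
    intro σ
    have hinj : Function.Injective (Φ σ) := by
      rw [injective_iff_map_eq_zero]
      intro u hu
      by_contra hne
      obtain ⟨i, hi⟩ := exists_coeff_ne_zero hne
      obtain ⟨a, ha⟩ := Ideal.Quotient.mk_surjective (Perfection.coeff _ p i u)
      have h1 := coeff_perfectionMap (σ : M →+* M) (hiso' σ) u ha
      have h2 : perfectionMap p r (σ : M →+* M) (hiso' σ) u = 0 := hu
      rw [h2, map_zero, eq_comm, mk_eq_zero_iff_norm_le] at h1
      rw [← ha, Ne, mk_eq_zero_iff_norm_le] at hi
      exact hi ((hiso σ a).symm.trans_le h1)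
    refine Finset.eq_of_subset_of_card_le ?_ (Finset.card_image_of_injective _ hinj).ge
    intro w hw
    obtain ⟨v, hv, rfl⟩ := Finset.mem_image.mp hw
    obtain ⟨hv1, hv2⟩ := (hmemY v).mp hv
    refine (hmemY _).mpr ⟨?_, ?_⟩
    · have hmap := hginv (σ : M →+* M) (hiso' σ) (fun a => by
        obtain ⟨l, hl⟩ := hj a
        rw [← hl]; exact σ.commutes l)
      have := hv1.map (f := Φ σ)
      rwa [hmap] at this
    · rw [coeff_perfectionMap (σ : M →+* M) (hiso' σ) v hv2.symm]
      congr 1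
      refine Subtype.ext ?_
      rw [coe_integerRingMap, ← hx₀]
      exact σ.commutes x₀
  have hsum : ∀ σ (F : Q → Q), ∑ v ∈ Y, F (Φ σ v) = ∑ v ∈ Y, F v := by
    intro σ F
    have hinj : Set.InjOn (Φ σ) Y :=
      Finset.card_image_iff.mp (by rw [hΦY])
    conv_rhs => rw [← hΦY σ, Finset.sum_image hinj]
  obtain ⟨e, he⟩ := exists_sum_pow_ne_zero hYne
  obtain ⟨i, hi⟩ := exists_coeff_ne_zero he
  -- With `C = T ^ (1 / p ^ (i + 2))` and `B = ∑ v ^ (e / p ^ (i + 2)) * v ^ (1 / p)`, the difference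
  -- `C ^ p * y - B ^ p = ∑ v ^ (e / p ^ (i + 1)) * (y - v)` has constant term zero.
  set T := ∑ v ∈ Y, v ^ e with hT
  set C : Q := perfectionRoot (i + 2) T with hC
  set B : Q := ∑ v ∈ Y, perfectionRoot (i + 2) v ^ e * perfectionRoot 1 v with hB
  have hCinv : ∀ σ, Φ σ C = C := by
    intro σ
    have h1 : Φ σ T = T := by
      rw [hT, map_sum]
      simp only [map_pow]
      exact hsum σ (fun v => v ^ e)
    rw [hC]
    change perfectionMap p r (σ : M →+* M) (hiso' σ) (perfectionRoot (i + 2) T) = _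
    rw [perfectionMap_perfectionRoot]
    exact congrArg _ h1
  have hBinv : ∀ σ, Φ σ B = B := by
    intro σ
    rw [hB, map_sum]
    refine Eq.trans (Finset.sum_congr rfl fun v _ => ?_)
      (hsum σ (fun v => perfectionRoot (i + 2) v ^ e * perfectionRoot 1 v))
    rw [map_mul, map_pow]
    exact congrArg₂ (fun a b => a ^ e * b)
      (perfectionMap_perfectionRoot (σ : M →+* M) (hiso' σ) (i + 2) v)
      (perfectionMap_perfectionRoot (σ : M →+* M) (hiso' σ) 1 v)
  have hCB : Perfection.coeff _ p 0 C ^ p * Ideal.Quotient.mk _ x = Perfection.coeff _ p 0 B ^ p := by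
    rw [hC, hB, hT, map_sum, map_sum, map_sum, sum_pow_char, sum_pow_char, Finset.sum_mul]
    refine Finset.sum_congr rfl fun v hv => ?_
    rw [← ((hmemY v).mp hv).2]
    simp only [map_mul, map_pow, mul_pow]
    congr 1
    rw [coeff_perfectionRoot]
    exact (Perfection.coeff_pow_p' v 0).symm
  obtain ⟨c, c', hcc, hc⟩ := exists_coeff_zero_eq_algebraMap hpM hpr' hr hiso C hCinv
  obtain ⟨b, b', hbb, hb⟩ := exists_coeff_zero_eq_algebraMap hpM hpr' hr hiso B hBinv
  rw [← hc, ← hb, ← map_pow, ← map_mul, ← map_pow, mk_eq_mk_iff_norm_sub_le] at hCB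
  have hCB' : ‖algebraMap L M (c ^ p * x₀ - b ^ p)‖ ≤ r := by
    simpa [hcc, hbb, hx₀] using hCB
  -- `c` lifts the coefficient of index `i + 2` of `T`, whose `i`-th coefficient is nonzero
  obtain ⟨t, ht⟩ := Ideal.Quotient.mk_surjective (Perfection.coeff _ p i T)
  have htr : (r : ℝ) < ‖(t : M)‖ := by
    rw [← ht, Ne, mk_eq_zero_iff_norm_le, not_le] at hi; exact hi
  have hct : ‖(c' : M)‖ ^ p ^ 2 = ‖(t : M)‖ := by
    refine norm_pow_eq_of_lifts_coeff T ht ?_ htr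
    rw [hc, hC, coeff_perfectionRoot, zero_add]
  set γ : ℝ := ‖algebraMap L M c‖ ^ p with hγ
  have hγp : (r : ℝ) < γ ^ p := by
    rw [hγ, hcc, ← pow_mul, ← sq, hct]; exact htr
  have hγ0 : 0 ≤ γ := by positivity
  have hγ1 : γ ≤ 1 := pow_le_one₀ (norm_nonneg _) (hcc ▸ norm_coe_integerRing_le_one c')
  have hγ2 : (r : ℝ) < γ ^ 2 := hγp.trans_le (pow_le_pow_of_le_one hγ0 hγ1 hp.1.two_le)
  have hγr : (r : ℝ) < γ := hγ2.trans_le (pow_le_of_le_one hγ0 hγ1 two_ne_zero)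
  have hγpos : 0 < γ := hr0.trans hγr
  have hc0 : c ≠ 0 := by
    rintro rfl
    simp [hγ, hp.1.ne_zero] at hγpos
  refine ⟨b / c, ?_, ?_⟩
  · have hbγ : ‖algebraMap L M b‖ ^ p ≤ γ := by
      have e1 : algebraMap L M b ^ p = algebraMap L M c ^ p * x -
          algebraMap L M (c ^ p * x₀ - b ^ p) := by
        simp [hx₀]
      rw [← norm_pow, e1, sub_eq_add_neg]
      refine (IsUltrametricDist.norm_add_le_max _ _).trans (max_le ?_ ?_)
      · rw [norm_mul, norm_pow]
        exact mul_le_of_le_one_right hγ0 (norm_coe_integerRing_le_one x)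
      · rw [norm_neg]; exact hCB'.trans hγr.le
    rw [map_div₀, norm_div]
    exact div_le_one_of_le₀ (le_of_pow_le_pow_left₀ hp.1.ne_zero (norm_nonneg _) hbγ)
      (norm_nonneg _)
  · have e2 : x₀ - (b / c) ^ p = (c ^ p * x₀ - b ^ p) / c ^ p := by
      rw [div_pow, sub_div, mul_div_cancel_left₀ _ (pow_ne_zero _ hc0)]
    rw [e2, map_div₀, norm_div, map_pow, norm_pow, ← hγ, div_pow, div_le_iff₀ (by positivity)]
    calc ‖algebraMap L M (c ^ p * x₀ - b ^ p)‖ ^ 2 ≤ (r : ℝ) ^ 2 := by gcongr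
      _ = (r : ℝ) * r := sq _
      _ ≤ (r : ℝ) * γ ^ 2 := by gcongr

end Approximation

/-! ### Values of norms close to one -/

section ValueGroup

/-- A nontrivial value group that is not discrete has elements arbitrarily close to `1`. -/
theorem exists_norm_mem_Ico {K : Type*} [NormedField K] [IsUltrametricDist K]
    (hnd : ¬ (NormedField.valuation (K := K)).IsRankOneDiscrete) {x₀ : K} (hx₀ : x₀ ≠ 0)
    (hx₁ : ‖x₀‖ < 1) {r : ℝ} (hr : r < 1) : ∃ ϖ : K, ϖ ≠ 0 ∧ r ≤ ‖ϖ‖ ∧ ‖ϖ‖ < 1 := by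
  by_contra! hcon
  apply hnd
  set v := NormedField.valuation (K := K) with hv
  set H := MonoidWithZeroHom.valueGroup (.ofClass v : K →*₀ ℝ≥0) with hH
  have hmem : ∀ γ : ℝ≥0ˣ, γ ∈ H ↔ ∃ x : K, x ≠ 0 ∧ ‖x‖₊ = γ := by
    intro γ
    have h := MonoidWithZeroHom.valueGroup_eq_range (f := (.ofClass v : K →*₀ ℝ≥0))
    have h1 : γ ∈ H ↔ (γ : ℝ≥0) ∈ Units.val '' (H : Set ℝ≥0ˣ) :=
      ⟨fun h => ⟨γ, h, rfl⟩, fun ⟨γ', h, e⟩ => Units.ext e ▸ h⟩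
    rw [h1, h]
    constructor
    · rintro ⟨⟨x, hx⟩, -⟩
      refine ⟨x, ?_, hx⟩
      rintro rfl
      exact γ.ne_zero (hx.symm.trans (map_zero _))
    · rintro ⟨x, -, hx⟩
      exact ⟨⟨x, hx⟩, γ.ne_zero⟩
  -- the value group meets `(max r ‖x₀‖, 1)` trivially, so it is cyclic
  set s : ℝ≥0 := ⟨max r ‖x₀‖, le_max_of_le_right (norm_nonneg _)⟩ with hs
  have hs0 : s ≠ 0 := by
    have : (0 : ℝ) < s := lt_max_of_lt_right (norm_pos_iff.mpr hx₀)
    exact_mod_cast this.ne'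
  have hs1 : s < 1 := by
    have : (s : ℝ) < 1 := max_lt hr hx₁
    exact_mod_cast this
  have hiso : Disjoint (H : Set ℝ≥0ˣ) (Set.Ioo 1 (Units.mk0 s hs0)⁻¹) := by
    rw [Set.disjoint_left]
    rintro γ hγ ⟨h1, h2⟩
    obtain ⟨x, hx0, hx⟩ := (hmem γ⁻¹).mp (inv_mem hγ)
    have h3 : γ⁻¹ < 1 := inv_lt_one'.mpr h1
    have h4 : Units.mk0 s hs0 < γ⁻¹ := lt_inv_of_lt_inv h2
    rw [← Units.val_lt_val, ← hx] at h3 h4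
    have h3' : ‖x‖ < 1 := by exact_mod_cast h3
    have h4' : (s : ℝ) < ‖x‖ := by exact_mod_cast h4
    exact absurd h3' (not_lt.mpr (hcon x hx0 ((le_max_left _ _).trans h4'.le)))
  obtain ⟨b, hb⟩ := Subgroup.cyclic_of_isolated_one
    (one_lt_inv'.mpr (by rw [← Units.val_lt_val]; exact hs1)) hiso
  rw [← Subgroup.zpowers_eq_closure] at hb
  refine ⟨?_⟩
  rcases lt_trichotomy b 1 with h | h | h
  · exact ⟨b, hb.symm, h⟩
  · exfalso
    have h1 : Units.mk0 ‖x₀‖₊ (by simpa using hx₀) ∈ H := (hmem _).mpr ⟨x₀, hx₀, rfl⟩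
    rw [hb, h, Subgroup.zpowers_one_eq_bot, Subgroup.mem_bot] at h1
    have h2 : ‖x₀‖₊ = 1 := congrArg Units.val h1
    have h3 : ‖x₀‖ = 1 := congrArg NNReal.toReal h2
    linarith
  · exact ⟨b⁻¹, by rw [Subgroup.zpowers_inv]; exact hb.symm, inv_lt_one'.mpr h⟩

end ValueGroup

/-! ### Kähler differentials -/

section Kaehler

/-- If modulo `ϖ ∣ p` every element of `B` is a `p`-th power, then `Ω = ϖ Ω`; if moreover `Ω` is
killed by a divisor of a power of `ϖ`, then `Ω = 0`. -/
theorem subsingleton_kaehlerDifferential {R B : Type*} [CommRing R] [CommRing B] [Algebra R B]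
    {p : ℕ} {ϖ : R} (hp : ϖ ∣ (p : R)) (h : ∀ x : B, ∃ a z : B, x = a ^ p + ϖ • z)
    {δ : B} (hδ : ∀ x : B, δ • KaehlerDifferential.D R B x = 0) {N : ℕ}
    (hN : δ ∣ algebraMap R B (ϖ ^ N)) : Subsingleton (Ω[B⁄R]) := by
  have hspan := KaehlerDifferential.span_range_derivation R B
  have hdiv : ∀ ω : Ω[B⁄R], ∃ ω', ω = algebraMap R B ϖ • ω' := by
    intro ω
    have hω : ω ∈ Submodule.span B (Set.range (KaehlerDifferential.D R B)) := by
      rw [hspan]; trivial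
    induction hω using Submodule.span_induction with
    | mem ω hω =>
      obtain ⟨x, rfl⟩ := hω
      obtain ⟨a, z, rfl⟩ := h x
      obtain ⟨c, hc⟩ := hp
      refine ⟨algebraMap R B c • a ^ (p - 1) • KaehlerDifferential.D R B a +
        KaehlerDifferential.D R B z, ?_⟩
      rw [map_add, Derivation.map_smul, Derivation.leibniz_pow, smul_add, ← mul_smul
        (algebraMap R B ϖ), ← map_mul, ← hc, map_natCast, Nat.cast_smul_eq_nsmul, algebraMap_smul]
    | zero => exact ⟨0, by simp⟩
    | add ω₁ ω₂ _ _ h₁ h₂ =>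
      obtain ⟨η₁, rfl⟩ := h₁
      obtain ⟨η₂, rfl⟩ := h₂
      exact ⟨η₁ + η₂, by rw [smul_add]⟩
    | smul b ω _ h =>
      obtain ⟨η, rfl⟩ := h
      exact ⟨b • η, smul_comm _ _ _⟩
  have hdivN : ∀ (N : ℕ) (ω : Ω[B⁄R]), ∃ ω', ω = algebraMap R B (ϖ ^ N) • ω' := by
    intro N
    induction N with
    | zero => exact fun ω => ⟨ω, by simp⟩
    | succ N ih =>
      intro ω
      obtain ⟨η, rfl⟩ := ih ω
      obtain ⟨η', rfl⟩ := hdiv η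
      exact ⟨η', by rw [← mul_smul, ← map_mul, pow_succ]⟩
  have hkill : ∀ ω : Ω[B⁄R], δ • ω = 0 := by
    intro ω
    have hω : ω ∈ Submodule.span B (Set.range (KaehlerDifferential.D R B)) := by
      rw [hspan]; trivial
    induction hω using Submodule.span_induction with
    | mem ω hω => obtain ⟨x, rfl⟩ := hω; exact hδ x
    | zero => simp
    | add ω₁ ω₂ _ _ h₁ h₂ => rw [smul_add, h₁, h₂, add_zero]
    | smul b ω _ h => rw [smul_comm, h, smul_zero]
  refine subsingleton_of_forall_eq 0 fun ω => ?_
  obtain ⟨η, rfl⟩ := hdivN N ω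
  obtain ⟨c, hc⟩ := hN
  rw [hc, mul_comm, mul_smul, hkill, smul_zero]

/-- Let `K = Frac R` with `R` integrally closed, and let `B` be a subring of a finite separable
extension `L` of `K` that consists of the elements integral over `R`. A single nonzero element of
`B`, namely a discriminant times a different, kills `Ω[B⁄R]`. -/
theorem exists_ne_zero_smul_D_eq_zero {R K L : Type*} [CommRing R] [IsDomain R]
    [IsIntegrallyClosed R] [Field K] [Field L] [Algebra R K] [IsFractionRing R K] [Algebra K L]
    [Algebra R L] [IsScalarTower R K L] [FiniteDimensional K L] [Algebra.IsSeparable K L]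
    (B : Subalgebra R L) (hB : ∀ x, x ∈ B ↔ IsIntegral R x) :
    ∃ δ : B, δ ≠ 0 ∧ ∀ x : B, δ • KaehlerDifferential.D R B x = 0 := by
  have hinj : Function.Injective (algebraMap R L) := by
    rw [IsScalarTower.algebraMap_eq R K L]
    exact (algebraMap K L).injective.comp (IsFractionRing.injective R K)
  have : FaithfulSMul R L := (faithfulSMul_iff_algebraMap_injective R L).mpr hinj
  have : Algebra.IsAlgebraic R L := (IsFractionRing.comap_isAlgebraic_iff (K := K)).mpr inferInstance
  -- an integral primitive element
  obtain ⟨α₀, hα₀⟩ := Field.exists_primitive_element K L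
  obtain ⟨c, hc0, hc⟩ :=
    (Algebra.IsAlgebraic.isAlgebraic (R := R) α₀).exists_integral_multiple
  set α : L := c • α₀ with hα
  have htop : Algebra.adjoin K {α} = ⊤ := by
    have h1 : IntermediateField.adjoin K {α} = ⊤ := by
      rw [eq_top_iff, ← hα₀, IntermediateField.adjoin_simple_le_iff]
      have hcK : algebraMap R K c ≠ 0 := by
        rwa [Ne, map_eq_zero_iff _ (IsFractionRing.injective R K)]
      have : α₀ = (algebraMap R K c)⁻¹ • α := by
        rw [hα, ← algebraMap_smul K c α₀, smul_smul, inv_mul_cancel₀ hcK, one_smul]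
      rw [this]
      exact IntermediateField.smul_mem _ (IntermediateField.mem_adjoin_simple_self K α)
    rw [← IntermediateField.adjoin_simple_toSubalgebra_of_isAlgebraic
      (Algebra.IsAlgebraic.isAlgebraic α), h1, IntermediateField.top_toSubalgebra]
  set pb := PowerBasis.ofAdjoinEqTop (hc.tower_top (A := K)) htop with hpb
  have hgen : pb.gen = α := PowerBasis.ofAdjoinEqTop_gen _ _
  have hpbint : IsIntegral R pb.gen := by rw [hgen]; exact hc
  obtain ⟨d, hd⟩ := IsIntegrallyClosed.algebraMap_eq_of_integral
    (Algebra.discr_isIntegral K (R := R) (b := pb.basis) fun i => by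
      rw [PowerBasis.basis_eq_pow]; exact hpbint.pow _)
  have hd0 : d ≠ 0 := by
    rintro rfl
    exact Algebra.discr_not_zero_of_basis K pb.basis (by rw [← hd, map_zero])
  let αB : B := ⟨α, (hB α).mpr hc⟩
  have hval : ∀ q : R[X], aeval α q = ((aeval αB q : B) : L) := fun q =>
    aeval_algHom_apply B.val αB q
  set f := minpoly R α with hf
  have hfB : aeval αB f = 0 := by
    refine Subtype.ext ?_
    rw [← hval]
    exact minpoly.aeval R α
  have hf' : aeval αB (derivative f) ≠ 0 := by
    intro h0
    have h1 : aeval α (derivative f) = 0 := by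
      have := congrArg (Subtype.val) h0
      rwa [← hval] at this
    have h2 := (Algebra.IsSeparable.isSeparable K α).aeval_derivative_ne_zero (minpoly.aeval K α)
    rw [minpoly.isIntegrallyClosed_eq_field_fractions' K hc, derivative_map, aeval_map_algebraMap]
      at h2
    exact h2 h1
  refine ⟨algebraMap R B d * aeval αB (derivative f), mul_ne_zero ?_ hf', fun x => ?_⟩
  · intro h0
    have := congrArg (Subtype.val) h0
    exact hd0 (hinj (by simpa using this))
  · have hx : IsIntegral R (x : L) := (hB _).mp x.2
    have h1 := Algebra.discr_mul_isIntegral_mem_adjoin K hpbint hx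
    rw [hgen, Algebra.adjoin_singleton_eq_range_aeval, ← hd, algebraMap_smul] at h1
    obtain ⟨g, hg⟩ := h1
    have hgB : d • x = aeval αB g := by
      refine Subtype.ext ?_
      rw [← hval]
      exact hg.symm
    have h2 : aeval αB (derivative f) • KaehlerDifferential.D R B αB = 0 := by
      rw [← Derivation.map_aeval, hfB, map_zero]
    rw [mul_comm, mul_smul, algebraMap_smul, ← Derivation.map_smul, hgB, Derivation.map_aeval,
      smul_comm, h2, smul_zero]

end Kaehler

/-! ### Extensions of perfectoid fields -/

section Extension

theorem isIntegral_iff_spectralNorm_le_one (K : Type*) [NormedField K] [IsUltrametricDist K]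
    {L : Type*} [Field L] [Algebra K L] [Algebra.IsAlgebraic K L] (x : L) :
    spectralNorm K L x ≤ 1 ↔ IsIntegral (integerRing K) x := by
  have hxK : IsIntegral K x := Algebra.IsIntegral.isIntegral x
  rw [spectralNorm, spectralValue_le_one_iff (minpoly.monic hxK)]
  constructor
  · intro h
    have hl : minpoly K x ∈ lifts (algebraMap (integerRing K) K) := by
      rw [lifts_iff_coeff_lifts]
      exact fun n => ⟨⟨_, mem_integerRing.mpr (h n)⟩, rfl⟩
    obtain ⟨g, hg1, -, hg2⟩ := lifts_and_natDegree_eq_and_monic hl (minpoly.monic hxK)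
    refine ⟨g, hg2, ?_⟩
    have := minpoly.aeval K x
    rwa [← hg1, aeval_map_algebraMap] at this
  · intro h n
    rw [minpoly.isIntegrallyClosed_eq_field_fractions' K h, coeff_map]
    exact norm_coe_integerRing_le_one _

variable {p : ℕ} [hp : Fact p.Prime] {K : Type*} [NormedField K] [IsUltrametricDist K]

theorem HasMixedCharacteristics.norm_p_lt_one (hK : HasMixedCharacteristics p K) :
    ‖(p : K)‖ < 1 := by
  rw [hK.norm_p]; exact inv_lt_one_of_one_lt₀ (by exact_mod_cast hp.1.one_lt)

theorem HasMixedCharacteristics.natCast_ne_zero (hK : HasMixedCharacteristics p K) :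
    (p : K) ≠ 0 := by
  rw [← norm_pos_iff, hK.norm_p]
  exact inv_pos.mpr (by exact_mod_cast hp.1.pos)

theorem HasMixedCharacteristics.charZero (hK : HasMixedCharacteristics p K) : CharZero K := by
  refine charZero_of_inj_zero fun n hn => ?_
  by_contra hn0
  rw [← Nat.ordProj_mul_ordCompl_eq_self n p, Nat.cast_mul, Nat.cast_pow] at hn
  have h1 := norm_natCast_eq_one_of_not_dvd hK.norm_p (Nat.not_dvd_ordCompl hp.1 hn0)
  rcases mul_eq_zero.mp hn with h | h
  · exact hK.natCast_ne_zero (eq_zero_of_pow_eq_zero h)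
  · rw [h, norm_zero] at h1; exact zero_ne_one h1

/-- In a finite extension `L` of a perfectoid field, every integral element is a `p`-th power up to
an error bounded away from `1`, uniformly in the element. -/
theorem IsPerfectoidField.exists_spectralNorm_sub_pow_le [CompleteSpace K]
    (hK : IsPerfectoidField p K) (L : Type*) [Field L] [Algebra K L] [FiniteDimensional K L] :
    ∃ r : ℝ, r < 1 ∧ ∀ x : L, spectralNorm K L x ≤ 1 →
      ∃ a : L, spectralNorm K L a ≤ 1 ∧ spectralNorm K L (x - a ^ p) ≤ r := by
  have hmix := hK.mixedCharacteristics
  have := hmix.charZero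
  have : CharZero L := charZero_of_injective_algebraMap (algebraMap K L).injective
  let _ : NontriviallyNormedField K :=
    { ‹NormedField K› with
      non_trivial := ⟨(p : K)⁻¹, by
        rw [norm_inv]
        exact one_lt_inv_iff₀.mpr ⟨norm_pos_iff.mpr hmix.natCast_ne_zero, hmix.norm_p_lt_one⟩⟩ }
  let M := AlgebraicClosure L
  have : Algebra.IsAlgebraic K M := Algebra.IsAlgebraic.trans K L M
  let _ : NormedField M := spectralNorm.normedField K M
  have : IsUltrametricDist M :=
    IsUltrametricDist.isUltrametricDist_of_isNonarchimedean_norm isNonarchimedean_spectralNorm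
  have hnorm : ∀ y : L, ‖algebraMap L M y‖ = spectralNorm K L y := fun y =>
    (spectralNorm.eq_of_tower (K := K) (L := M) y).symm
  have hKM : ∀ y : K, ‖algebraMap K M y‖ = ‖y‖ := fun y => spectralNorm_extends y
  have hiso : ∀ (σ : M ≃ₐ[L] M) (y : M), ‖σ y‖ = ‖y‖ := fun σ y =>
    (spectralNorm_eq_of_equiv (σ.restrictScalars K) y).symm
  have hpM : ‖(p : M)‖ = (p : ℝ)⁻¹ := by
    rw [← map_natCast (algebraMap K M), hKM, hmix.norm_p]
  let j : integerRing K →+* integerRing M :=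
    ((algebraMap K M).comp (integerRing K).subtype).codRestrict (integerRing M) fun y =>
      mem_integerRing.mpr ((hKM y).trans_le (norm_coe_integerRing_le_one y))
  have hpu : (p : integerRing K) ∈ nonunits (integerRing K) := by
    intro hu
    obtain ⟨c, hc⟩ := isUnit_iff_exists_inv.mp hu
    have h1 := norm_le_of_natCast_dvd (M := K) (p := p) (x := 1) ⟨c, hc.symm⟩
    simp only [OneMemClass.coe_one, norm_one] at h1
    exact absurd hmix.norm_p_lt_one (not_lt.mpr h1)
  have := CharP.quotient (integerRing K) p hpu
  set n := Module.finrank K L with hn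
  have hn0 : n ≠ 0 := Module.finrank_pos.ne'
  set r : ℝ≥0 := (p : ℝ≥0)⁻¹ ^ (n : ℝ)⁻¹ with hr
  have hrn : r ^ n = (p : ℝ≥0)⁻¹ := NNReal.rpow_inv_natCast_pow _ hn0
  have hr1 : r < 1 := by
    refine NNReal.rpow_lt_one ?_ (by positivity)
    exact inv_lt_one_of_one_lt₀ (by exact_mod_cast hp.1.one_lt)
  refine ⟨√r, by rw [Real.sqrt_lt' one_pos]; simpa using hr1, fun x hx => ?_⟩
  have hint := (isIntegral_iff_spectralNorm_le_one K x).mp hx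
  set f := minpoly (integerRing K) x with hf
  have hfd : f.natDegree = (minpoly K x).natDegree := by
    rw [minpoly.isIntegrallyClosed_eq_field_fractions' K hint, (minpoly.monic hint).natDegree_map]
  have hxM : algebraMap L M x ∈ integerRing M := mem_integerRing.mpr ((hnorm x).trans_le hx)
  have hev : f.eval₂ j ⟨_, hxM⟩ = 0 := by
    refine Subtype.ext ?_
    have h1 := hom_eval₂ f j (integerRing M).subtype ⟨_, hxM⟩
    refine h1.trans ?_
    have h2 : (integerRing M).subtype.comp j =
        (algebraMap L M).comp (algebraMap (integerRing K) L) := by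
      ext y
      exact IsScalarTower.algebraMap_apply K L M (y : K)
    rw [h2]
    change f.eval₂ _ (algebraMap L M x) = 0
    rw [← hom_eval₂, ← aeval_def, hf, minpoly.aeval, map_zero]
  obtain ⟨a, ha1, ha2⟩ := exists_norm_sub_pow_le (L := L) hK.frobenius_surjective hpM hiso j
    (fun y => ⟨algebraMap K L y, (IsScalarTower.algebraMap_apply K L M (y : K)).symm⟩)
    (minpoly.monic hint) (minpoly.natDegree_pos hint).ne' hev rfl hr1 (by
      have h1 : r ^ n ≤ r ^ f.natDegree :=
        pow_le_pow_of_le_one r.2 hr1.le (hfd ▸ minpoly.natDegree_le x)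
      rw [hrn] at h1
      rw [hpM]
      exact_mod_cast h1)
  refine ⟨a, (hnorm a).symm.trans_le ha1, ?_⟩
  rw [← hnorm]
  exact Real.le_sqrt_of_sq_le ha2

end Extension

theorem theoremT (p : ℕ) [Fact p.Prime] (K : Type u) [NormedField K]
    [IsUltrametricDist K] [CompleteSpace K] (hK : IsPerfectoidField p K) :
    IsDeeplyRamified.{u, v} K := by
  intro L _ _ _
  have hmix := hK.mixedCharacteristics
  have := hmix.charZero
  obtain ⟨r, hr, hroot⟩ := hK.exists_spectralNorm_sub_pow_le L
  obtain ⟨ϖ, hϖ0, hϖr, hϖ1⟩ := exists_norm_mem_Ico hK.not_discrete hmix.natCast_ne_zero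
    hmix.norm_p_lt_one (max_lt hr hmix.norm_p_lt_one)
  let ϖ' : integerRing K := ⟨ϖ, mem_integerRing.mpr hϖ1.le⟩
  obtain ⟨δ, hδ0, hδ⟩ := exists_ne_zero_smul_D_eq_zero (K := K) (extensionIntegerRing K L)
    (isIntegral_iff_spectralNorm_le_one K)
  have hsmul : ∀ (c : K) (y : L), spectralNorm K L (c • y) = ‖c‖ * spectralNorm K L y :=
    fun c y => spectralNorm_smul c (Algebra.IsAlgebraic.isAlgebraic y)
  have hδL : (δ : L) ≠ 0 := fun h => hδ0 (Subtype.ext h)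
  obtain ⟨N, hN⟩ : ∃ N : ℕ, spectralNorm K L (ϖ ^ N • (δ : L)⁻¹) ≤ 1 := by
    have hpos : 0 < spectralNorm K L (δ : L)⁻¹ :=
      spectralNorm_zero_lt (inv_ne_zero hδL) (Algebra.IsAlgebraic.isAlgebraic _)
    obtain ⟨N, hN⟩ := exists_pow_lt_of_lt_one (inv_pos.mpr hpos) hϖ1
    refine ⟨N, ?_⟩
    rw [hsmul, norm_pow, ← le_div_iff₀ hpos, one_div]
    exact hN.le
  -- errors of norm at most `r`, and `p` itself, are multiples of `ϖ ∈ K`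
  refine subsingleton_kaehlerDifferential (p := p) (ϖ := ϖ') ?_ (fun x => ?_) hδ (N := N) ?_
  · refine ⟨⟨p / ϖ, mem_integerRing.mpr ?_⟩, Subtype.ext ?_⟩
    · rw [norm_div]
      exact div_le_one_of_le₀ ((le_max_right _ _).trans hϖr) (norm_nonneg _)
    · change (p : K) = ϖ * (p / ϖ)
      rw [mul_div_cancel₀ _ hϖ0]
  · obtain ⟨a, ha1, ha2⟩ := hroot x x.2
    refine ⟨⟨a, ha1⟩, ⟨ϖ⁻¹ • ((x : L) - a ^ p), ?_⟩, Subtype.ext ?_⟩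
    · change spectralNorm K L _ ≤ 1
      rw [hsmul, norm_inv, inv_mul_eq_div]
      exact div_le_one_of_le₀ (ha2.trans ((le_max_left _ _).trans hϖr)) (norm_nonneg _)
    · change (x : L) = a ^ p + ϖ • ϖ⁻¹ • ((x : L) - a ^ p)
      rw [smul_inv_smul₀ hϖ0, add_sub_cancel]
  · refine ⟨⟨_, hN⟩, Subtype.ext ?_⟩
    change algebraMap K L (ϖ ^ N) = (δ : L) * (ϖ ^ N • (δ : L)⁻¹)
    rw [mul_smul_comm, mul_inv_cancel₀ hδL, Algebra.algebraMap_eq_smul_one]
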